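/- Let $M$ be a connected smooth manifold of dimension $n\ge 3$, equipped with a conformal structure $[g]$ of (possibly indefinite) pseudo-Riemannian metrics, that is, an equivalence class of smooth metrics under $g\sim e^{2\Upsilon}g$ with $\Upsilon\in C^\infty(M)$. Let $1\le k\le n-1$. A smooth $k$-form $\sigma$ of conformal weight $k+1$ assigns to each metric $g$ in the conformal class a smooth $k$-form $\sigma_g$ on $M$ such that $\sigma_{e^{2\Upsilon}g}=e^{(k+1)\Upsilon}\sigma_g$; it vanishes at a point $x$ if $\sigma_g(x)=0$ for every (equivalently, for one) $g\in[g]$. It is a conformal Killing form if, for every (equivalently, for one) $g$ in the conformal class with Levi-Civita connection $\nabla$, at each point of $M$ there are a $(k-1)$-form $\tau$ and a $(k+1)$-form $\rho$ such that $$\nabla_u\sigma_g=g(u,\cdot)\wedge\tau+\iota_u\rho\qquad\text{for all tangent vectors }u .$$ If $\sigma$ is a conformal Killing form that is not identically zero, then $\{x\in M:\sigma(x)\neq 0\}$ is an open dense subset of $M$. -/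

import Mathlib

open scoped Manifold ContDiff

namespace ConfKilling

/-- The model space `ℝⁿ` of an `n`-dimensional manifold. -/
abbrev Model (n : ℕ) : Type := EuclideanSpace ℝ (Fin n)

section Coordinates

variable {n : ℕ}

/-- The Christoffel symbols `Γ(u, v)`, at the point `y`, of a field `G` of nondegenerate symmetric
bilinear forms on (an open subset of) `ℝⁿ`.  It is the vector determined by the Koszul formula
`2 G(Γ(u, v), w) = (D_u G)(v, w) + (D_v G)(u, w) - (D_w G)(u, v)` for all `w`. -/
noncomputable def christoffel (G : Model n → Model n →L[ℝ] Model n →L[ℝ] ℝ) (y u v : Model n) :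
    Model n :=
  ContinuousLinearMap.inverse (G y)
    ((1 / 2 : ℝ) • (fderiv ℝ G y u v + fderiv ℝ G y v u - ((fderiv ℝ G y).flip u).flip v))

/-- The value `(∇_u s)(v₁, …, v_k)` at `y` of the Levi-Civita covariant derivative for `G` of a
`k`-form `s` on (an open subset of) `ℝⁿ`:
`(D_u s)(v₁, …, v_k) - ∑ i, s(v₁, …, Γ(u, v_i), …, v_k)`. -/
noncomputable def covDeriv {k : ℕ} (G : Model n → Model n →L[ℝ] Model n →L[ℝ] ℝ)
    (s : Model n → Model n [⋀^Fin k]→L[ℝ] ℝ) (y u : Model n) (v : Fin k → Model n) : ℝ :=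
  fderiv ℝ s y u v - ∑ i, s y (Function.update v i (christoffel G y u (v i)))

/-- The conformal Killing equation for the `(k + 1)`-form `s` at the point `y`: there are a
`k`-form `τ` and a `(k + 2)`-form `ρ` at `y` such that `∇_u s = u♭ ∧ τ + ι(u) ρ` for every tangent
vector `u`, where `u♭ = G(u, ·)`.  Equivalently `∇ s` at `y` lies in the sum of the two
non-Cartan summands of `T* ⊗ Λ^(k+1) T*`. -/
def ConformalKillingAt {k : ℕ} (G : Model n → Model n →L[ℝ] Model n →L[ℝ] ℝ)
    (s : Model n → Model n [⋀^Fin (k + 1)]→L[ℝ] ℝ) (y : Model n) : Prop :=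
  ∃ (τ : Model n [⋀^Fin k]→L[ℝ] ℝ) (ρ : Model n [⋀^Fin (k + 2)]→L[ℝ] ℝ),
    ∀ (u : Model n) (v : Fin (k + 1) → Model n),
      covDeriv G s y u v =
        (∑ i : Fin (k + 1), (-1 : ℝ) ^ (i : ℕ) * G y u (v i) * τ (i.removeNth v)) +
          ρ (Fin.cons u v)

end Coordinates

section Manifold

variable {n : ℕ} {M : Type*} [TopologicalSpace M] [ChartedSpace (Model n) M]

/-- The inverse of the differential of the chart `e`, as a map from `ℝⁿ` to the tangent space at
the point with coordinates `y`: it sends the standard basis to the coordinate vector fields. -/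
noncomputable def chartFrame (e : OpenPartialHomeomorph M (Model n)) (y : Model n) :
    Model n →L[ℝ] TangentSpace (𝓡 n) (e.symm y) :=
  mfderiv (𝓡 n) (𝓡 n) e.symm y

/-- The coordinate expression in the chart `e` of a field `g` of bilinear forms on `M`: at `y` it is
`(u, v) ↦ g(A u, A v)` with `A = chartFrame e y`. -/
noncomputable def bilinInChart
    (g : ∀ x : M, TangentSpace (𝓡 n) x →L[ℝ] TangentSpace (𝓡 n) x →L[ℝ] ℝ)
    (e : OpenPartialHomeomorph M (Model n)) (y : Model n) : Model n →L[ℝ] Model n →L[ℝ] ℝ :=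
  (ContinuousLinearMap.precomp ℝ (chartFrame e y)) ∘L (g (e.symm y)) ∘L (chartFrame e y)

/-- The coordinate expression in the chart `e` of a field of `k`-forms on `M`. -/
noncomputable def formInChart {k : ℕ} (s : ∀ x : M, TangentSpace (𝓡 n) x [⋀^Fin k]→L[ℝ] ℝ)
    (e : OpenPartialHomeomorph M (Model n)) (y : Model n) : Model n [⋀^Fin k]→L[ℝ] ℝ :=
  (s (e.symm y)).compContinuousLinearMap (chartFrame e y)

variable (n M)

/-- A smooth pseudo-Riemannian metric: a symmetric, nondegenerate bilinear form on every tangent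
space, with smooth components in every chart of the atlas.  (On a connected manifold the signature
of such a metric is automatically constant.) -/
structure PseudoRiemannianMetric where
  /-- the bilinear form on the tangent space at `x` -/
  val : ∀ x : M, TangentSpace (𝓡 n) x →L[ℝ] TangentSpace (𝓡 n) x →L[ℝ] ℝ
  symm : ∀ (x : M) (u v : TangentSpace (𝓡 n) x), val x u v = val x v u
  nondegenerate : ∀ (x : M) (u : TangentSpace (𝓡 n) x), (∀ v, val x u v = 0) → u = 0
  smooth : ∀ e ∈ atlas (Model n) M, ContDiffOn ℝ ∞ (bilinInChart val e) e.target

/-- A smooth differential `k`-form: an alternating `k`-linear form on every tangent space, with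
smooth components in every chart of the atlas. -/
structure DiffForm (k : ℕ) where
  /-- the alternating form on the tangent space at `x` -/
  val : ∀ x : M, TangentSpace (𝓡 n) x [⋀^Fin k]→L[ℝ] ℝ
  smooth : ∀ e ∈ atlas (Model n) M, ContDiffOn ℝ ∞ (formInChart val e) e.target

variable {n M}

/-- `g' = e^{2Υ} g` -/
def IsRescaling (g g' : PseudoRiemannianMetric n M) (Υ : M → ℝ) : Prop :=
  ContMDiff (𝓡 n) 𝓘(ℝ) ∞ Υ ∧ ∀ x, g'.val x = Real.exp (2 * Υ x) • g.val x

variable (n M)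

/-- A conformal structure: an equivalence class `[g]` of smooth pseudo-Riemannian metrics under
`g ∼ e^{2Υ} g`, with `Υ` a smooth function. -/
structure ConformalStructure where
  /-- the metrics in the conformal class -/
  metrics : Set (PseudoRiemannianMetric n M)
  nonempty : metrics.Nonempty
  mem_iff : ∀ g ∈ metrics, ∀ g', g' ∈ metrics ↔ ∃ Υ, IsRescaling g g' Υ

variable {n M}

/-- A (smooth) `k`-form of conformal weight `w`, that is, a section of `Λ^k T*M ⊗ E[w]`: every
metric `g` in the conformal class trivialises `E[w]` and so yields a `k`-form `σ_g`, and the forms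
for `g` and `e^{2Υ} g` are related by `σ_{e^{2Υ} g} = e^{w Υ} σ_g`. -/
structure WeightedForm (c : ConformalStructure n M) (k : ℕ) (w : ℝ) where
  /-- the `k`-form `σ_g` that represents the weighted form in the scale `g` -/
  rep : c.metrics → DiffForm n M k
  rescale : ∀ (g g' : c.metrics) (Υ : M → ℝ), IsRescaling g.1 g'.1 Υ →
    ∀ x, (rep g').val x = Real.exp (w * Υ x) • (rep g).val x

variable {c : ConformalStructure n M}

/-- The weighted form vanishes at the point `x`. -/
def WeightedForm.VanishesAt {k : ℕ} {w : ℝ} (σ : WeightedForm c k w) (x : M) : Prop :=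
  ∀ g : c.metrics, (σ.rep g).val x = 0

/-- A conformal Killing form of degree `k + 1`: a `(k + 1)`-form of conformal weight `k + 2` that
satisfies the conformal Killing equation, with respect to the metrics of the conformal class.
(The equation is conformally invariant and tensorial.) -/
def WeightedForm.IsConformalKilling {k : ℕ} (σ : WeightedForm c (k + 1) (k + 2)) : Prop :=
  ∀ g : c.metrics, ∀ e ∈ atlas (Model n) M, ∀ y ∈ e.target,
    ConformalKillingAt (bilinInChart g.1.val e) (formInChart (σ.rep g).val e) y

end Manifold

end ConfKilling

/-!
The proof is a unique continuation argument: a conformal Killing form `σ` that vanishes on a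
neighbourhood of some points arbitrarily close to `x` vanishes near `x`.  Hence the interior of
the zero set is open and closed, and on a connected manifold it is empty unless `σ` is identically
zero.

Unique continuation holds because the conformal Killing equation is of finite type.  In a chart,
the equation says that `Ds - Γ·s` lies in the range of the bundle map `Ψ : (τ, ρ) ↦ (u ↦ u♭ ∧ τ +
ι(u) ρ)` (`killingPart`).  The range of `Ψ` is the symbol of the equation, and its second
prolongation is zero when the dimension is at least three and the degree of the form is neither
zero nor the dimension: a tensor `T(a, b, c; ·)` that is totally symmetric in `a`, `b`, `c` and is
of the form `c♭ ∧ τ + ι(c) ρ` for all fixed `a` and `b` vanishes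
(`eq_zero_of_symmetric_of_mem_range_killingPart`).  This is proved on the components in an
orthogonal basis (`IsKillingSymbol₃.eq_zero`), where the elimination of `τ` and `ρ` leaves two
rules for exchanging a covariant index with an index of the form.

A smooth family of linear maps with kernel the range of `Ψ` at a given point turns the equation
into a linear one; differentiated twice, it determines the third derivatives of `s` up to terms of
lower order, so that `‖D³s‖ ≤ C ‖(s, Ds, D²s)‖` locally (`exists_norm_third_fderiv_le`).  Only
this estimate is needed, and none of the curvature terms of a complete prolongation.  Grönwall's
inequality along segments then carries the vanishing of the two-jet of `s` from one point to a
whole ball (`eventually_eq_zero_of_mem_closure`).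
-/

namespace ConfKilling

/-! ### The prolonged symbol in an orthogonal basis -/

section Symbol

open Function Set

variable {n k : ℕ} {ε : Fin n → ℝ}

/-- The linear relations satisfied by the components `F b I = T(e_b; e_{I 0}, …, e_{I k})` of a
tensor of the form `T(u; ·) = u♭ ∧ τ + ι(u) ρ`, in a basis that is orthogonal with
`g(e_b, e_b) = ε b`.  They result from the elimination of `τ` and `ρ`. -/
structure IsKillingSymbol (ε : Fin n → ℝ) (F : Fin n → (Fin (k + 1) → Fin n) → ℝ) : Prop where
  swap : ∀ b I i j, i ≠ j → F b (I ∘ Equiv.swap i j) = -F b I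
  skew : ∀ b I i, Injective I → b ∉ range I → F b I = -F (I i) (update I i b)
  trace : ∀ c I i, Injective I → c ∉ range I → ε c * F (I i) I = ε (I i) * F c (update I i c)

lemma exists_notMem_range (I : Fin (k + 1) → Fin n) (hk : k + 2 ≤ n) : ∃ c, c ∉ range I := by
  by_contra! h
  have := Fintype.card_le_of_surjective I h
  simp at this
  omega

lemma exists_ne_ne (hn : 3 ≤ n) (a c : Fin n) : ∃ b, b ≠ a ∧ b ≠ c := by
  obtain ⟨b, hb⟩ := Finset.exists_mem_notMem_of_card_lt_card (s := {a, c}) (t := Finset.univ)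
    (by have := Finset.card_le_two (a := a) (b := c); simp only [Finset.card_univ,
          Fintype.card_fin]; omega)
  exact ⟨b, by simpa using hb⟩

lemma notMem_range_update {I : Fin k → Fin n} {i : Fin k} {x c : Fin n} (hxc : x ≠ c)
    (hx : x ∉ range I) : x ∉ range (update I i c) := by
  rintro ⟨j, rfl⟩
  by_cases hj : j = i
  · subst hj; simp at hxc
  · rw [update_of_ne hj] at hx
    exact hx ⟨j, rfl⟩

lemma apply_notMem_range_update {I : Fin k → Fin n} (hI : Injective I) {i : Fin k} {c : Fin n}
    (hc : c ∉ range I) : I i ∉ range (update I i c) := by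
  rintro ⟨j, hj⟩
  by_cases hji : j = i
  · subst hji; rw [update_self] at hj; exact hc ⟨j, hj.symm⟩
  · rw [update_of_ne hji] at hj
    exact hji (hI hj)

lemma injective_update {I : Fin k → Fin n} (hI : Injective I) {i : Fin k} {c : Fin n}
    (hc : c ∉ range I) : Injective (update I i c) := by
  intro x y h
  by_cases hx : x = i <;> by_cases hy : y = i
  · rw [hx, hy]
  · rw [hx, update_self, update_of_ne hy] at h; exact absurd ⟨y, h.symm⟩ hc
  · rw [hy, update_self, update_of_ne hx] at h; exact absurd ⟨x, h⟩ hc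
  · rw [update_of_ne hx, update_of_ne hy] at h; exact hI h

lemma update_swap {I : Fin k → Fin n} {i j : Fin k} (hij : i ≠ j) {c : Fin n} :
    update (update (update I i c) j (I i)) i (I j) = I ∘ Equiv.swap i j := by
  rw [update_comm hij.symm, update_idem]
  ext x
  by_cases hx : x = i
  · subst hx; simp [update_of_ne hij]
  by_cases hx' : x = j
  · subst hx'; simp
  · simp [update_of_ne hx, update_of_ne hx', Equiv.swap_apply_of_ne_of_ne hx hx']

/-- The components of an element of the first prolongation: symmetric in two covariant indices and
of Killing type in each. -/
structure IsKillingSymbol₂ (ε : Fin n → ℝ) (A : Fin n → Fin n → (Fin (k + 1) → Fin n) → ℝ) :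
    Prop where
  symm : ∀ a b I, A a b I = A b a I
  symbol : ∀ a, IsKillingSymbol ε (A a)

namespace IsKillingSymbol₂

variable {A : Fin n → Fin n → (Fin (k + 1) → Fin n) → ℝ} {I : Fin (k + 1) → Fin n}

/-- The three indices `a`, `b`, `I 0` can be permuted cyclically, each exchange with the form
costing a sign; three exchanges lead back to the original component. -/
lemma eq_zero_of_notMem (hA : IsKillingSymbol₂ ε A) (hI : Injective I) {a b : Fin n} (hab : a ≠ b)
    (ha : a ∉ range I) (hb : b ∉ range I) : A a b I = 0 := by
  have h1 := (hA.symbol a).skew b I 0 hI hb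
  have h2 := (hA.symbol (I 0)).skew a (update I 0 b) 0 (injective_update hI hb)
    (notMem_range_update hab ha)
  have h3 := (hA.symbol b).skew (I 0) (update I 0 a) 0 (injective_update hI ha)
    (apply_notMem_range_update hI ha)
  simp only [update_self, update_idem, update_eq_self] at h1 h2 h3
  rw [hA.symm a (I 0)] at h1
  rw [hA.symm (I 0) b] at h2
  rw [hA.symm b a] at h3
  linarith

/-- An index `c` outside of the form is used to exchange the entries at the places `i` and `j` by
three trace relations. -/
lemma eq_zero_of_ne (hA : IsKillingSymbol₂ ε A) (hε : ∀ i, ε i ≠ 0) (hk : k + 2 ≤ n)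
    (hI : Injective I) {i j : Fin (k + 1)} (hij : i ≠ j) : A (I i) (I j) I = 0 := by
  obtain ⟨c, hc⟩ := exists_notMem_range I hk
  have hI1 := injective_update (i := i) hI hc
  have ha1 := apply_notMem_range_update (i := i) hI hc
  have hI2 := injective_update (i := j) hI1 ha1
  have hb2 := apply_notMem_range_update (i := j) hI1 ha1
  have h1 := (hA.symbol (I j)).trace c I i hI hc
  have h2 := (hA.symbol c).trace (I i) _ j hI1 ha1
  have h3 := (hA.symbol (I i)).trace (I j) (update (update I i c) j (I i)) i hI2
    (by simpa [update_of_ne hij.symm] using hb2)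
  have h4 := (hA.symbol (I i)).swap (I j) I i j hij
  simp only [update_of_ne hij, update_of_ne hij.symm, update_self] at h1 h2 h3
  rw [update_swap hij, h4] at h3
  rw [hA.symm (I j) (I i), hA.symm (I j) c] at h1
  rw [hA.symm c (I i)] at h2
  have : ε c * A (I i) (I j) I = 0 := by linarith
  exact (mul_eq_zero.1 this).resolve_left (hε c)

/-- The relation `skew` links `A a a I`, and the relation `trace` links `A (I i) (I i) I`, to the
same component `A a (I i) (update I i a)`. -/
lemma mul_diag (hA : IsKillingSymbol₂ ε A) (hI : Injective I) {a : Fin n} (ha : a ∉ range I)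
    (i : Fin (k + 1)) : ε (I i) * A a a I = - (ε a * A (I i) (I i) I) := by
  have h1 := (hA.symbol a).skew a I i hI ha
  have h2 := (hA.symbol (I i)).trace a I i hI ha
  rw [hA.symm (I i) a] at h2
  rw [h1, h2]
  ring

end IsKillingSymbol₂

/-- The components of an element of the second prolongation: totally symmetric in three covariant
indices and of Killing type in each. -/
structure IsKillingSymbol₃ (ε : Fin n → ℝ)
    (T : Fin n → Fin n → Fin n → (Fin (k + 1) → Fin n) → ℝ) : Prop where
  symm : ∀ a b c I, T a b c I = T b a c I
  symbol₂ : ∀ a, IsKillingSymbol₂ ε (T a)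

namespace IsKillingSymbol₃

variable {T : Fin n → Fin n → Fin n → (Fin (k + 1) → Fin n) → ℝ} {I : Fin (k + 1) → Fin n}

lemma mul_diag_update (hT : IsKillingSymbol₃ ε T) (hI : Injective I) {c : Fin n}
    (hc : c ∉ range I) (i : Fin (k + 1)) :
    ε (I i) * T c c c I = ε c * T (I i) (I i) (I i) (update I i c) := by
  have h1 := (hT.symbol₂ c).mul_diag hI hc i
  have h2 := ((hT.symbol₂ (I i)).symbol (I i)).skew c I i hI hc
  rw [hT.symm c (I i), (hT.symbol₂ (I i)).symm c (I i)] at h1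
  rw [h1, h2]
  ring

/-- If the form has degree at least two, three indices are rotated through two of its places;
otherwise a third index supplies a component to which `IsKillingSymbol₂.eq_zero_of_notMem`
applies. -/
lemma diag_eq_zero_of_notMem (hT : IsKillingSymbol₃ ε T) (hε : ∀ i, ε i ≠ 0) (hn : 3 ≤ n)
    (hI : Injective I) {c : Fin n} (hc : c ∉ range I) : T c c c I = 0 := by
  rcases Nat.eq_zero_or_pos k with rfl | hk
  · have : Subsingleton (Fin (0 + 1)) := inferInstanceAs (Subsingleton (Fin 1))
    obtain ⟨b, hbc, hb0⟩ := exists_ne_ne hn c (I 0)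
    have hb : b ∉ range I := by
      rintro ⟨j, rfl⟩
      exact hb0 (by rw [Subsingleton.elim j 0])
    have h0 := (hT.symbol₂ b).eq_zero_of_notMem hI hbc.symm hc hb
    have h1 := (hT.symbol₂ c).mul_diag hI hb 0
    have h2 := (hT.symbol₂ c).mul_diag hI hc 0
    rw [hT.symm c b b, h0, mul_zero, eq_comm, neg_eq_zero] at h1
    rw [(mul_eq_zero.1 h1).resolve_left (hε b), mul_zero, neg_zero] at h2
    exact (mul_eq_zero.1 h2).resolve_left (hε _)
  · let i : Fin (k + 1) := 0
    let j : Fin (k + 1) := Fin.last k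
    have hij : i ≠ j := by simp [i, j, Fin.ext_iff]; omega
    have hI1 := injective_update (i := i) hI hc
    have ha1 := apply_notMem_range_update (i := i) hI hc
    have hI2 := injective_update (i := j) hI1 ha1
    have hb2 := apply_notMem_range_update (i := j) hI1 ha1
    have h1 := hT.mul_diag_update hI hc i
    have h2 := hT.mul_diag_update hI1 ha1 j
    have h3 := hT.mul_diag_update hI2 hb2 i
    have h4 := ((hT.symbol₂ c).symbol c).swap c I i j hij
    simp only [update_of_ne hij, update_of_ne hij.symm, update_self] at h1 h2 h3
    rw [update_swap hij, h4] at h3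
    have : (ε (I i) * ε (I j) * ε c) * T c c c I = 0 := by
      linear_combination (ε (I j) * ε c / 2) * h1 + (ε c * ε c / 2) * h2 + (ε c * ε (I i) / 2) * h3
    refine (mul_eq_zero.1 this).resolve_left ?_
    exact mul_ne_zero (mul_ne_zero (hε _) (hε _)) (hε _)

/-- In degree at least two this reduces to `IsKillingSymbol₂.eq_zero_of_ne`; in degree one, three
indices are compared pairwise. -/
lemma diag_eq_zero_of_mem (hT : IsKillingSymbol₃ ε T) (hε : ∀ i, ε i ≠ 0) (hn : 3 ≤ n)
    (hk : k + 2 ≤ n) (hI : Injective I) (i : Fin (k + 1)) : T (I i) (I i) (I i) I = 0 := by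
  rcases Nat.eq_zero_or_pos k with rfl | hk0
  · have : Subsingleton (Fin (0 + 1)) := inferInstanceAs (Subsingleton (Fin 1))
    -- for a one-form, `X c = T(e_c, e_c, e_c; e_c)` satisfies `X c / (ε c)² = - X a / (ε a)²`
    have key : ∀ a c : Fin n, a ≠ c → ε a ^ 2 * T c c c (fun _ => c) =
        - (ε c ^ 2 * T a a a (fun _ => a)) := by
      intro a c hac
      have hI' (x : Fin n) : Injective (fun _ : Fin (0 + 1) => x) := injective_of_subsingleton _
      have hu (x y : Fin n) : update (fun _ : Fin (0 + 1) => x) 0 y = fun _ => y := by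
        ext j; rw [Subsingleton.elim j 0, update_self]
      have h1 := (hT.symbol₂ c).mul_diag (hI' c) (a := a) (by simpa using hac) 0
      have h2 := (hT.symbol₂ a).mul_diag (hI' a) (a := c) (by simpa using hac.symm) 0
      have h3 := ((hT.symbol₂ a).symbol c).skew a (fun _ => c) 0 (hI' c) (by simpa using hac)
      rw [hu] at h3
      rw [hT.symm c a] at h1
      rw [h3] at h1
      linear_combination ε a * h1 + ε c * h2
    obtain ⟨a, hac, -⟩ := exists_ne_ne hn (I i) (I i)
    obtain ⟨b, hbc, hba⟩ := exists_ne_ne hn (I i) a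
    have e : I = fun _ => I i := by ext j; rw [Subsingleton.elim j i]
    have h1 := key a (I i) hac
    have h2 := key b a hba
    have h3 := key (I i) b hbc.symm
    rw [← e] at h1 h3
    have : (ε a * ε b) ^ 2 * T (I i) (I i) (I i) I = 0 := by
      linear_combination (ε b ^ 2 / 2) * h1 - (ε (I i) ^ 2 / 2) * h2 + (ε a ^ 2 / 2) * h3
    exact (mul_eq_zero.1 this).resolve_left (pow_ne_zero _ (mul_ne_zero (hε _) (hε _)))
  · have : Nontrivial (Fin (k + 1)) := Fin.nontrivial_iff_two_le.2 (by omega)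
    obtain ⟨j, hj⟩ := exists_ne i
    obtain ⟨a, ha⟩ := exists_notMem_range I hk
    have h1 := (hT.symbol₂ (I i)).mul_diag hI ha i
    have h2 := (hT.symbol₂ (I i)).mul_diag hI ha j
    rw [hT.symm (I i) (I j), (hT.symbol₂ (I j)).eq_zero_of_ne hε hk hI hj.symm, mul_zero,
      neg_zero] at h2
    rw [(mul_eq_zero.1 h2).resolve_left (hε _), mul_zero, eq_comm, neg_eq_zero] at h1
    exact (mul_eq_zero.1 h1).resolve_left (hε _)

lemma diag_eq_zero (hT : IsKillingSymbol₃ ε T) (hε : ∀ i, ε i ≠ 0) (hn : 3 ≤ n)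
    (hk : k + 2 ≤ n) (hI : Injective I) (c : Fin n) : T c c c I = 0 := by
  by_cases hc : c ∈ range I
  · obtain ⟨i, rfl⟩ := hc
    exact hT.diag_eq_zero_of_mem hε hn hk hI i
  · exact hT.diag_eq_zero_of_notMem hε hn hI hc

lemma eq_zero_of_same_side (hT : IsKillingSymbol₃ ε T) (hε : ∀ i, ε i ≠ 0)
    (hk : k + 2 ≤ n) (hI : Injective I) (a : Fin n) {b c : Fin n} (hbc : b ≠ c)
    (h : b ∈ range I ↔ c ∈ range I) : T a b c I = 0 := by
  by_cases hc : c ∈ range I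
  · obtain ⟨i, rfl⟩ := h.2 hc
    obtain ⟨j, rfl⟩ := hc
    exact (hT.symbol₂ a).eq_zero_of_ne hε hk hI (fun e => hbc (by rw [e]))
  · exact (hT.symbol₂ a).eq_zero_of_notMem hI hbc (fun hb => hc (h.1 hb)) hc

lemma eq_zero_of_eq (hT : IsKillingSymbol₃ ε T) (hε : ∀ i, ε i ≠ 0) (hn : 3 ≤ n)
    (hk : k + 2 ≤ n) (hI : Injective I) (a b : Fin n) : T a b b I = 0 := by
  rcases eq_or_ne a b with rfl | hab
  · exact hT.diag_eq_zero hε hn hk hI a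
  have hd := hT.diag_eq_zero hε hn hk hI a
  by_cases ha : a ∈ range I <;> by_cases hb : b ∈ range I
  · rw [hT.symm]
    exact hT.eq_zero_of_same_side hε hk hI b hab (by simp [ha, hb])
  · obtain ⟨i, rfl⟩ := ha
    have := (hT.symbol₂ (I i)).mul_diag hI hb i
    rw [hd, mul_zero, neg_zero] at this
    exact (mul_eq_zero.1 this).resolve_left (hε _)
  · obtain ⟨i, rfl⟩ := hb
    have := (hT.symbol₂ a).mul_diag hI ha i
    rw [hd, mul_zero, eq_comm, neg_eq_zero] at this
    exact (mul_eq_zero.1 this).resolve_left (hε _)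
  · rw [hT.symm]
    exact hT.eq_zero_of_same_side hε hk hI b hab (by simp [ha, hb])

/-- The second prolongation of the symbol vanishes.  Of three distinct covariant indices two lie on
the same side of the division into indices of the form and other indices. -/
theorem eq_zero (hT : IsKillingSymbol₃ ε T) (hε : ∀ i, ε i ≠ 0) (hn : 3 ≤ n)
    (hk : k + 2 ≤ n) (hI : Injective I) (a b c : Fin n) : T a b c I = 0 := by
  have symm' (a b c) : T a b c I = T a c b I := (hT.symbol₂ a).symm b c I
  rcases eq_or_ne b c with rfl | hbc
  · exact hT.eq_zero_of_eq hε hn hk hI a b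
  rcases eq_or_ne a c with rfl | hac
  · rw [hT.symm]
    exact hT.eq_zero_of_eq hε hn hk hI b a
  rcases eq_or_ne a b with rfl | hab
  · rw [symm', hT.symm]
    exact hT.eq_zero_of_eq hε hn hk hI c a
  by_cases h1 : b ∈ range I ↔ c ∈ range I
  · exact hT.eq_zero_of_same_side hε hk hI a hbc h1
  by_cases h2 : a ∈ range I ↔ c ∈ range I
  · rw [hT.symm]
    exact hT.eq_zero_of_same_side hε hk hI b hac h2
  · rw [symm', hT.symm]
    exact hT.eq_zero_of_same_side hε hk hI c hab (by tauto)

end IsKillingSymbol₃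

end Symbol

/-! ### The symbol of the conformal Killing operator -/

section Algebra

-- the normed structures on iterated spaces of linear maps are found only at this depth
set_option maxSynthPendingDepth 3

open Function Set ContinuousLinearMap ContinuousAlternatingMap

variable {n k : ℕ}

instance finiteDimensional_continuousAlternatingMap :
    FiniteDimensional ℝ (Model n [⋀^Fin k]→L[ℝ] ℝ) := by
  let f : (Model n [⋀^Fin k]→L[ℝ] ℝ) →ₗ[ℝ] MultilinearMap ℝ (fun _ : Fin k => Model n) ℝ :=
    { toFun := fun φ => φ.toMultilinearMap
      map_add' := fun _ _ => rfl
      map_smul' := fun _ _ => rfl }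
  refine Module.Finite.of_injective f fun φ ψ h => ?_
  ext v
  exact congrArg (fun m => m v) h

/-- The linear map `(τ, ρ) ↦ (u ↦ u♭ ∧ τ + ι(u) ρ)`, with `u♭ = B(u, ·)`. -/
noncomputable def killingPart (k : ℕ) (B : Model n →L[ℝ] Model n →L[ℝ] ℝ) :
    (Model n [⋀^Fin k]→L[ℝ] ℝ) × (Model n [⋀^Fin (k + 2)]→L[ℝ] ℝ) →L[ℝ]
      Model n →L[ℝ] Model n [⋀^Fin (k + 1)]→L[ℝ] ℝ :=
  ((compL ℝ _ _ _).flip B ∘L compL ℝ _ _ _ (alternatizeUncurryFinCLM ℝ (Model n) ℝ) ∘L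
      (smulRightL ℝ (Model n) (Model n [⋀^Fin k]→L[ℝ] ℝ)).flip) ∘L .fst ℝ _ _ +
    (curryLeftLI : _ →ₗᵢ[ℝ] Model n →L[ℝ] Model n [⋀^Fin (k + 1)]→L[ℝ] ℝ).toContinuousLinearMap ∘L
      .snd ℝ _ _

lemma killingPart_apply (B : Model n →L[ℝ] Model n →L[ℝ] ℝ)
    (t : (Model n [⋀^Fin k]→L[ℝ] ℝ) × (Model n [⋀^Fin (k + 2)]→L[ℝ] ℝ)) (u : Model n)
    (v : Fin (k + 1) → Model n) :
    killingPart k B t u v =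
      (∑ i : Fin (k + 1), (-1 : ℝ) ^ (i : ℕ) * B u (v i) * t.1 (i.removeNth v)) +
        t.2 (Fin.cons u v) := by
  simp [killingPart, alternatizeUncurryFin_apply, mul_assoc, Matrix.vecCons]

lemma contDiff_killingPart : ContDiff ℝ ω (killingPart (n := n) k) := by
  unfold killingPart
  fun_prop

/-- The linear map that sends a form `φ` to `u ↦ ∑ i, φ(…, Γ(u, v_i), …)`. -/
noncomputable def connectionPart (k : ℕ) (Γ : Model n →L[ℝ] Model n →L[ℝ] Model n) :
    (Model n [⋀^Fin (k + 1)]→L[ℝ] ℝ) →L[ℝ] Model n →L[ℝ] Model n [⋀^Fin (k + 1)]→L[ℝ] ℝ :=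
  compL ℝ _ _ _ (alternatizeUncurryFinCLM ℝ (Model n) ℝ) ∘L (compL ℝ _ _ _).flip Γ ∘L
    compL ℝ (Model n) (Model n) (Model n [⋀^Fin k]→L[ℝ] ℝ) ∘L curryLeftLI.toContinuousLinearMap

lemma connectionPart_apply (Γ : Model n →L[ℝ] Model n →L[ℝ] Model n)
    (φ : Model n [⋀^Fin (k + 1)]→L[ℝ] ℝ) (u : Model n) (v : Fin (k + 1) → Model n) :
    connectionPart k Γ φ u v = ∑ i, φ (update v i (Γ u (v i))) := by
  have h : connectionPart k Γ φ u v =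
      ∑ i : Fin (k + 1), (-1 : ℤ) ^ (i : ℕ) • φ (Matrix.vecCons (Γ u (v i)) (i.removeNth v)) := by
    have h' : connectionPart k Γ φ u = alternatizeUncurryFin (curryLeft φ ∘L Γ u) := rfl
    rw [h', alternatizeUncurryFin_apply]
    rfl
  rw [h]
  refine Finset.sum_congr rfl fun i _ => ?_
  rw [← φ.neg_one_pow_smul_map_insertNth i, smul_smul, ← mul_pow, Fin.insertNth_removeNth]
  simp

lemma contDiff_connectionPart : ContDiff ℝ ω (connectionPart (n := n) k) := by
  unfold connectionPart
  fun_prop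

/-- A nondegenerate symmetric bilinear form has an orthogonal basis. -/
lemma exists_orthogonal_basis (B : Model n →L[ℝ] Model n →L[ℝ] ℝ) (hs : ∀ u v, B u v = B v u)
    (hn : ∀ u, (∀ v, B u v = 0) → u = 0) :
    ∃ e : Module.Basis (Fin n) ℝ (Model n), (∀ i j, i ≠ j → B (e i) (e j) = 0) ∧
      ∀ i, B (e i) (e i) ≠ 0 := by
  have : Invertible (2 : ℝ) := invertibleOfNonzero two_ne_zero
  let β : LinearMap.BilinForm ℝ (Model n) := B.toLinearMap₁₂
  have hβ : ∀ u v, β u v = B u v := fun _ _ => rfl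
  obtain ⟨e, he⟩ := LinearMap.BilinForm.exists_orthogonal_basis (B := β) ⟨fun u v => hs u v⟩
  have hd : Module.finrank ℝ (Model n) = n := by simp
  refine ⟨e.reindex (finCongr hd), fun i j hij => ?_, fun i => ?_⟩
  · simp only [Module.Basis.reindex_apply]
    exact he (by simpa using hij)
  · simp only [Module.Basis.reindex_apply]
    exact he.not_isOrtho_basis_self_of_separatingLeft (fun u hu => hn u hu) _

variable {B : Model n →L[ℝ] Model n →L[ℝ] ℝ} {e : Module.Basis (Fin n) ℝ (Model n)}

lemma killingPart_apply_of_notMem (he : ∀ i j, i ≠ j → B (e i) (e j) = 0)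
    (t : (Model n [⋀^Fin k]→L[ℝ] ℝ) × (Model n [⋀^Fin (k + 2)]→L[ℝ] ℝ)) {b : Fin n}
    {I : Fin (k + 1) → Fin n} (hb : b ∉ range I) :
    killingPart k B t (e b) (e ∘ I) = t.2 (Fin.cons (e b) (e ∘ I)) := by
  rw [killingPart_apply, Finset.sum_eq_zero, zero_add]
  intro i _
  rw [comp_apply, he b (I i) (fun h => hb ⟨i, h.symm⟩), mul_zero, zero_mul]

lemma killingPart_apply_mem (he : ∀ i j, i ≠ j → B (e i) (e j) = 0)
    (t : (Model n [⋀^Fin k]→L[ℝ] ℝ) × (Model n [⋀^Fin (k + 2)]→L[ℝ] ℝ))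
    {I : Fin (k + 1) → Fin n} (hI : Injective I) (i : Fin (k + 1)) :
    killingPart k B t (e (I i)) (e ∘ I) =
      (-1 : ℝ) ^ (i : ℕ) * B (e (I i)) (e (I i)) * t.1 (i.removeNth (e ∘ I)) := by
  have h : t.2 (Fin.cons (e (I i)) (e ∘ I)) = 0 :=
    t.2.map_eq_zero_of_eq _ (i := 0) (j := i.succ) (by simp) (Fin.succ_ne_zero i).symm
  rw [killingPart_apply, h, add_zero, Finset.sum_eq_single i]
  · rfl
  · intro j _ hj
    rw [comp_apply, he _ _ (hI.ne hj.symm), mul_zero, zero_mul]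
  · simp

lemma isKillingSymbol_killingPart (he : ∀ i j, i ≠ j → B (e i) (e j) = 0)
    (t : (Model n [⋀^Fin k]→L[ℝ] ℝ) × (Model n [⋀^Fin (k + 2)]→L[ℝ] ℝ)) :
    IsKillingSymbol (fun i => B (e i) (e i)) (fun b I => killingPart k B t (e b) (e ∘ I)) where
  swap b I i j hij := (killingPart k B t (e b)).toAlternatingMap.map_swap (e ∘ I) hij
  skew b I i hI hb := by
    rw [killingPart_apply_of_notMem he t hb,
      killingPart_apply_of_notMem he t (apply_notMem_range_update hI hb)]
    have h := t.2.toAlternatingMap.map_swap (Fin.cons (e b) (e ∘ I)) (Fin.succ_ne_zero i).symm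
    have h' : (Fin.cons (e b) (e ∘ I) : Fin (k + 2) → Model n) ∘ Equiv.swap 0 i.succ =
        Fin.cons (e (I i)) (e ∘ update I i b) := by
      ext1 x
      refine Fin.cases ?_ (fun x => ?_) x
      · simp
      · by_cases hx : x = i
        · subst hx; simp
        · rw [comp_apply, Equiv.swap_apply_of_ne_of_ne (Fin.succ_ne_zero x) (by simpa using hx)]
          simp [update_of_ne hx]
    rw [h'] at h
    exact (neg_eq_iff_eq_neg.2 h).symm
  trace c I i hI hc := by
    have h := killingPart_apply_mem he t (injective_update (i := i) hI hc) i
    have h' : i.removeNth (e ∘ update I i c) = i.removeNth (e ∘ I) := by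
      ext1 x
      simp [Fin.removeNth]
    rw [update_self, h'] at h
    rw [killingPart_apply_mem he t hI i, h]
    ring

lemma killingPart_injective (hk : k + 2 ≤ n) (hs : ∀ u v, B u v = B v u)
    (hn : ∀ u, (∀ v, B u v = 0) → u = 0) : Injective (killingPart k B) := by
  obtain ⟨e, he, he'⟩ := exists_orthogonal_basis B hs hn
  rw [injective_iff_map_eq_zero]
  intro t ht
  have h0 (b : Fin n) (I : Fin (k + 1) → Fin n) : killingPart k B t (e b) (e ∘ I) = 0 := by
    rw [ht]; rfl
  refine Prod.ext ?_ ?_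
  · refine toAlternatingMap_injective (e.ext_alternating fun J hJ => ?_)
    obtain ⟨b, hb⟩ : ∃ b, b ∉ range J := by
      by_contra! h
      have := Fintype.card_le_of_surjective J h
      simp at this
      omega
    have h := killingPart_apply_mem he t (Fin.cons_injective_iff.2 ⟨hb, hJ⟩) 0
    have h' : Fin.removeNth 0 (e ∘ (Fin.cons b J : Fin (k + 1) → Fin n)) = fun i => e (J i) := by
      ext1 x
      simp [Fin.removeNth]
    rw [h0, h'] at h
    simpa [he' b] using h
  · refine toAlternatingMap_injective (e.ext_alternating fun J hJ => ?_)
    have h := killingPart_apply_of_notMem he t (b := J 0) (I := Fin.tail J) (by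
      rintro ⟨j, hj⟩
      exact Fin.succ_ne_zero j (hJ hj))
    rw [h0] at h
    have h' : (Fin.cons (e (J 0)) (e ∘ Fin.tail J) : Fin (k + 2) → Model n) =
        fun i => e (J i) := by
      ext1 x
      refine Fin.cases ?_ (fun x => ?_) x <;> simp [Fin.tail]
    rw [h'] at h
    exact h.symm

/-- The symbol of the conformal Killing operator is of finite type: its second prolongation
vanishes, so that the third derivatives of a solution are determined by those of lower order. -/
theorem eq_zero_of_symmetric_of_mem_range_killingPart (hn3 : 3 ≤ n) (hk : k + 2 ≤ n)
    (hs : ∀ u v, B u v = B v u) (hn : ∀ u, (∀ v, B u v = 0) → u = 0)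
    {T : Model n →L[ℝ] Model n →L[ℝ] Model n →L[ℝ] Model n [⋀^Fin (k + 1)]→L[ℝ] ℝ}
    (h12 : ∀ a b c, T a b c = T b a c) (h23 : ∀ a b c, T a b c = T a c b)
    (hT : ∀ a b, T a b ∈ range (killingPart k B)) : T = 0 := by
  obtain ⟨e, he, he'⟩ := exists_orthogonal_basis B hs hn
  have hS : IsKillingSymbol₃ (fun i => B (e i) (e i))
      (fun a b c (I : Fin (k + 1) → Fin n) => T (e a) (e b) (e c) (e ∘ I)) :=
    { symm := fun a b c I => by rw [h12]
      symbol₂ := fun a =>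
        { symm := fun b c I => by rw [h23]
          symbol := fun b => by
            obtain ⟨t, ht⟩ := hT (e a) (e b)
            simp only [← ht]
            exact isKillingSymbol_killingPart he t } }
  have h (a b c : Fin n) : T (e a) (e b) (e c) = 0 :=
    toAlternatingMap_injective (e.ext_alternating fun I hI => hS.eq_zero he' hn3 hk hI a b c)
  have h' (a b : Fin n) : T (e a) (e b) = 0 :=
    coe_injective (e.ext fun c => h a b c)
  have h'' (a : Fin n) : T (e a) = 0 :=
    coe_injective (e.ext fun b => h' a b)
  exact coe_injective (e.ext fun a => h'' a)

end Algebra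

/-! ### Unique continuation for overdetermined systems of finite type -/

section FiniteType

-- the normed structures on iterated spaces of linear maps are found only at this depth
set_option maxSynthPendingDepth 3

open Function Set ContinuousLinearMap Filter Topology

variable {V E W X N : Type*}
  [NormedAddCommGroup V] [NormedSpace ℝ V] [NormedAddCommGroup E] [NormedSpace ℝ E]
  [NormedAddCommGroup W] [NormedSpace ℝ W] [NormedAddCommGroup X] [NormedSpace ℝ X]
  [NormedAddCommGroup N] [NormedSpace ℝ N]

lemma eventually_norm_le_of_injective [FiniteDimensional ℝ X] {Z : Type*} [TopologicalSpace Z]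
    {L : Z → X →L[ℝ] W} {y₀ : Z}
    (hL : ContinuousAt L y₀) (hinj : Injective (L y₀)) :
    ∃ C : ℝ, ∀ᶠ y in 𝓝 y₀, ∀ x, ‖x‖ ≤ C * ‖L y x‖ := by
  obtain ⟨K, hK0, hK⟩ := (L y₀).toLinearMap.exists_antilipschitzWith
    (LinearMap.ker_eq_bot.2 hinj)
  have hK0' : (0 : ℝ) < K := hK0
  refine ⟨2 * K, ?_⟩
  have h := Metric.continuousAt_iff'.1 hL (1 / (2 * K)) (by positivity)
  filter_upwards [h] with y hy x
  have h1 : ‖x‖ ≤ K * ‖L y₀ x‖ := by simpa using hK.le_mul_dist x 0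
  have h2 : ‖(L y - L y₀) x‖ ≤ 1 / (2 * K) * ‖x‖ :=
    (L y - L y₀).le_of_opNorm_le (by rw [← dist_eq_norm]; exact hy.le) x
  have h3 : ‖L y₀ x‖ ≤ ‖L y x‖ + ‖(L y - L y₀) x‖ := by
    rw [sub_apply, norm_sub_rev]
    calc ‖L y₀ x‖ = ‖L y x + (L y₀ x - L y x)‖ := by congr 1; abel
      _ ≤ _ := norm_add_le _ _
  have h4 : K * ‖(L y - L y₀) x‖ ≤ ‖x‖ / 2 := by
    calc K * ‖(L y - L y₀) x‖ ≤ K * (1 / (2 * K) * ‖x‖) := by gcongr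
      _ = ‖x‖ / 2 := by field_simp
  have h5 : K * ‖L y₀ x‖ ≤ K * (‖L y x‖ + ‖(L y - L y₀) x‖) := by gcongr
  linarith

lemma eventually_norm_le_of_injOn [FiniteDimensional ℝ X] {Z : Type*} [TopologicalSpace Z]
    {L : Z → X →L[ℝ] W} {y₀ : Z} (S : Submodule ℝ X)
    (hL : ContinuousAt L y₀) (hinj : ∀ x ∈ S, L y₀ x = 0 → x = 0) :
    ∃ C : ℝ, ∀ᶠ y in 𝓝 y₀, ∀ x ∈ S, ‖x‖ ≤ C * ‖L y x‖ := by
  obtain ⟨C, hC⟩ := eventually_norm_le_of_injective (L := fun y => L y ∘L S.subtypeL) (y₀ := y₀)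
    (((compL ℝ S X W).flip S.subtypeL).continuous.continuousAt.comp hL)
    ((injective_iff_map_eq_zero _).2 fun x hx => Subtype.ext (hinj x x.2 hx))
  exact ⟨C, hC.mono fun y hy x hx => hy ⟨x, hx⟩⟩

lemma contDiffAt_compL (U : Type*) [NormedAddCommGroup U] [NormedSpace ℝ U] {P : V → X →L[ℝ] W}
    {y₀ : V} (hP : ContDiffAt ℝ ∞ P y₀) : ContDiffAt ℝ ∞ (fun y => compL ℝ U X W (P y)) y₀ :=
  (compL ℝ U X W).contDiff.contDiffAt.comp y₀ hP

/-- A smooth family of injective linear maps is annihilated by a smooth family of linear maps, with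
kernel the range of the given map at the base point: with a left inverse `R` of `Ψ y₀`, it is
`1 - Ψ (R Ψ)⁻¹ R`. -/
lemma exists_contDiffAt_annihilator [FiniteDimensional ℝ N] [FiniteDimensional ℝ W]
    {Ψ : V → N →L[ℝ] W} {y₀ : V} (hΨ : ContDiffAt ℝ ∞ Ψ y₀) (hinj : Injective (Ψ y₀)) :
    ∃ P : V → W →L[ℝ] W, ContDiffAt ℝ ∞ P y₀ ∧ (∀ᶠ y in 𝓝 y₀, ∀ t, P y (Ψ y t) = 0) ∧
      ∀ w, P y₀ w = 0 → w ∈ range (Ψ y₀) := by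
  have : CompleteSpace N := FiniteDimensional.complete ℝ N
  obtain ⟨R', hR'⟩ := (Ψ y₀).toLinearMap.exists_leftInverse_of_injective
    (LinearMap.ker_eq_bot.2 hinj)
  let R : W →L[ℝ] N := R'.toContinuousLinearMap
  have hR : R ∘L Ψ y₀ = (ContinuousLinearEquiv.refl ℝ N : N →L[ℝ] N) := by
    ext t
    exact congrArg (fun f => f t) hR'
  have hRΨ : ContDiffAt ℝ ∞ (fun y => R ∘L Ψ y) y₀ := contDiffAt_const.clm_comp hΨ
  have hinv : ContDiffAt ℝ ∞ (fun y => inverse (R ∘L Ψ y)) y₀ := by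
    have h : ContDiffAt ℝ ∞ inverse ((ContinuousLinearEquiv.refl ℝ N : N ≃L[ℝ] N) : N →L[ℝ] N) :=
      contDiffAt_map_inverse _
    rw [← hR] at h
    exact h.comp y₀ hRΨ
  refine ⟨fun y => ContinuousLinearMap.id ℝ W - Ψ y ∘L inverse (R ∘L Ψ y) ∘L R,
    contDiffAt_const.sub (hΨ.clm_comp (hinv.clm_comp contDiffAt_const)), ?_, ?_⟩
  · have hmem : range ((↑) : (N ≃L[ℝ] N) → N →L[ℝ] N) ∈ 𝓝 (R ∘L Ψ y₀) := by
      rw [hR]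
      exact ContinuousLinearEquiv.nhds (ContinuousLinearEquiv.refl ℝ N)
    filter_upwards [hRΨ.continuousAt hmem] with y ⟨f, hf⟩ t
    have hf' : inverse (R ∘L Ψ y) = (f.symm : N →L[ℝ] N) := by
      rw [show R ∘L Ψ y = f from hf.symm, inverse_equiv]
    have h1 : R (Ψ y t) = f t := (congrArg (fun g : N →L[ℝ] N => g t) hf).symm
    simp [hf', h1]
  · intro w hw
    refine ⟨inverse (R ∘L Ψ y₀) (R w), ?_⟩
    have : w - Ψ y₀ (inverse (R ∘L Ψ y₀) (R w)) = 0 := hw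
    exact (sub_eq_zero.1 this).symm

lemma eventually_differentiableAt {f : V → E} {y₀ : V} (hf : ContDiffAt ℝ ∞ f y₀) :
    ∀ᶠ y in 𝓝 y₀, DifferentiableAt ℝ f y :=
  ((hf.of_le (m := 1) (by exact_mod_cast le_top)).eventually (by simp)).mono
    fun _ hy => hy.differentiableAt one_ne_zero

/-- Differentiation of a linear equation `P(y)(Dm) = A(y) j` for the derivative of `m` gives an
equation of the same type for the second derivative of `m`. -/
lemma exists_differentiated_equation {P : V → (V →L[ℝ] E) →L[ℝ] W} {A : V → X →L[ℝ] W} {m : V → E}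
    {j : V → X} {y₀ : V} (hP : ContDiffAt ℝ ∞ P y₀) (hA : ContDiffAt ℝ ∞ A y₀)
    (hm : ContDiffAt ℝ ∞ m y₀) (hj : ContDiffAt ℝ ∞ j y₀)
    (h : ∀ᶠ y in 𝓝 y₀, P y (fderiv ℝ m y) = A y (j y)) :
    ∃ A' : V → X × (V →L[ℝ] E) × (V →L[ℝ] X) →L[ℝ] V →L[ℝ] W, ContDiffAt ℝ ∞ A' y₀ ∧
      ∀ᶠ y in 𝓝 y₀, compL ℝ V _ _ (P y) (fderiv ℝ (fderiv ℝ m) y) =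
        A' y (j y, fderiv ℝ m y, fderiv ℝ j y) := by
  have hDm : ContDiffAt ℝ ∞ (fderiv ℝ m) y₀ := hm.fderiv_right le_rfl
  refine ⟨fun y => (fderiv ℝ A y).flip ∘L .fst ℝ _ _ +
      compL ℝ V X W (A y) ∘L .snd ℝ _ _ ∘L .snd ℝ _ _ -
      (fderiv ℝ P y).flip ∘L .fst ℝ _ _ ∘L .snd ℝ _ _, ?_, ?_⟩
  · have hDA : ContDiffAt ℝ ∞ (fun y => (fderiv ℝ A y).flip) y₀ :=
      (flipₗᵢ ℝ V X W).contDiff.contDiffAt.comp y₀ (hA.fderiv_right le_rfl)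
    have hDP : ContDiffAt ℝ ∞ (fun y => (fderiv ℝ P y).flip) y₀ :=
      (flipₗᵢ ℝ V (V →L[ℝ] E) W).contDiff.contDiffAt.comp y₀ (hP.fderiv_right le_rfl)
    exact ((hDA.clm_comp contDiffAt_const).add
      ((contDiffAt_compL V hA).clm_comp contDiffAt_const)).sub (hDP.clm_comp contDiffAt_const)
  · filter_upwards [h.eventually_nhds, eventually_differentiableAt hP,
      eventually_differentiableAt hA, eventually_differentiableAt hDm, eventually_differentiableAt hj] with y hy hPy hAy hDmy hjy
    have h1 := hPy.hasFDerivAt.clm_apply hDmy.hasFDerivAt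
    have h2 := hAy.hasFDerivAt.clm_apply hjy.hasFDerivAt
    have h3 := h1.unique (h2.congr_of_eventuallyEq hy)
    ext v
    have h4 := congrArg (fun f => f v) h3
    simp only [add_apply, ContinuousLinearMap.comp_apply, flip_apply] at h4
    simp only [compL_apply, ContinuousLinearMap.comp_apply, sub_apply, add_apply,
      flip_apply, coe_fst', coe_snd']
    rw [eq_sub_iff_add_eq, h4, add_comm]

lemma eventually_fderiv_fderiv_symm {f : V → E} {y₀ : V} (hf : ContDiffAt ℝ ∞ f y₀) :
    ∀ᶠ y in 𝓝 y₀, ∀ a b, fderiv ℝ (fderiv ℝ f) y a b = fderiv ℝ (fderiv ℝ f) y b a :=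
  ((hf.of_le (m := 2) (WithTop.coe_le_coe.2 le_top)).eventually (by simp)).mono
    fun _ hy a b => hy.isSymmSndFDerivAt (by simp) a b

lemma eventually_fderiv_fderiv_fderiv_symm {f : V → E} {y₀ : V} (hf : ContDiffAt ℝ ∞ f y₀) :
    ∀ᶠ y in 𝓝 y₀, ∀ a b c, fderiv ℝ (fderiv ℝ (fderiv ℝ f)) y a b c =
      fderiv ℝ (fderiv ℝ (fderiv ℝ f)) y a c b := by
  have hD2 : ContDiffAt ℝ ∞ (fderiv ℝ (fderiv ℝ f)) y₀ :=
    (hf.fderiv_right le_rfl).fderiv_right le_rfl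
  filter_upwards [(eventually_fderiv_fderiv_symm hf).eventually_nhds,
    eventually_differentiableAt hD2] with y hy hd a b c
  have h1 := (flipₗᵢ ℝ V V E).toContinuousLinearEquiv.toContinuousLinearMap.hasFDerivAt.comp y
    hd.hasFDerivAt
  have h2 := h1.congr_of_eventuallyEq (f₁ := fderiv ℝ (fderiv ℝ f)) (hy.mono fun z hz => by
    ext a b
    exact hz a b)
  have h3 := congrArg (fun T => T a b c) (hd.hasFDerivAt.unique h2)
  exact h3

set_option maxHeartbeats 800000 in
/-- If the equation `Ds ∈ A s + range Ψ` has vanishing second prolongation, then the third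
derivatives of a solution are bounded by those of lower order. -/
theorem exists_norm_third_fderiv_le [FiniteDimensional ℝ V] [FiniteDimensional ℝ E]
    [FiniteDimensional ℝ N] {s : V → E} {Ψ : V → N →L[ℝ] V →L[ℝ] E} {A : V → E →L[ℝ] V →L[ℝ] E}
    {y₀ : V} (hs : ContDiffAt ℝ ∞ s y₀) (hΨ : ContDiffAt ℝ ∞ Ψ y₀) (hA : ContDiffAt ℝ ∞ A y₀)
    (heq : ∀ᶠ y in 𝓝 y₀, ∃ t, fderiv ℝ s y = A y (s y) + Ψ y t) (hinj : Injective (Ψ y₀))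
    (hfin : ∀ T : V →L[ℝ] V →L[ℝ] V →L[ℝ] E, (∀ a b c, T a b c = T b a c) →
      (∀ a b c, T a b c = T a c b) → (∀ a b, T a b ∈ range (Ψ y₀)) → T = 0) :
    ∃ C : ℝ, ∀ᶠ y in 𝓝 y₀, ‖fderiv ℝ (fderiv ℝ (fderiv ℝ s)) y‖ ≤
      C * ‖(s y, fderiv ℝ s y, fderiv ℝ (fderiv ℝ s) y)‖ := by
  obtain ⟨P, hP, hPΨ, hPker⟩ := exists_contDiffAt_annihilator hΨ hinj
  have hDs : ContDiffAt ℝ ∞ (fderiv ℝ s) y₀ := hs.fderiv_right le_rfl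
  have h0 : ∀ᶠ y in 𝓝 y₀, P y (fderiv ℝ s y) = (P y ∘L A y) (s y) := by
    filter_upwards [heq, hPΨ] with y ⟨t, ht⟩ hy
    rw [ht, map_add, hy, add_zero, ContinuousLinearMap.comp_apply]
  obtain ⟨A₁, hA₁, h1⟩ := exists_differentiated_equation hP (hP.clm_comp hA) hs hs h0
  have hP₁ := contDiffAt_compL V hP
  obtain ⟨A₂, hA₂, h2⟩ := exists_differentiated_equation hP₁ hA₁ hDs
    (hs.prodMk (hDs.prodMk hDs)) h1
  -- the tensors that are symmetric in their three covariant arguments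
  let S : Submodule ℝ (V →L[ℝ] V →L[ℝ] V →L[ℝ] E) :=
    { carrier := {T | (∀ a b c, T a b c = T b a c) ∧ ∀ a b c, T a b c = T a c b}
      zero_mem' := by simp
      add_mem' := fun {T T'} h h' => ⟨fun a b c => by simp [h.1 a b c, h'.1 a b c],
        fun a b c => by simp [h.2 a b c, h'.2 a b c]⟩
      smul_mem' := fun r T h => ⟨fun a b c => by simp [h.1 a b c], fun a b c => by
        simp [h.2 a b c]⟩ }
  obtain ⟨C, hC⟩ := eventually_norm_le_of_injOn S (contDiffAt_compL V hP₁).continuousAt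
    fun T hT hPT => hfin T hT.1 hT.2 fun a b => hPker _ (congrArg (fun f => f a b) hPT)
  have hA₂b : ∀ᶠ y in 𝓝 y₀, ‖A₂ y‖ < ‖A₂ y₀‖ + 1 :=
    hA₂.continuousAt.norm.eventually_lt_const (lt_add_one _)
  refine ⟨|C| * (‖A₂ y₀‖ + 1), ?_⟩
  filter_upwards [hC, hA₂b, h2, eventually_fderiv_fderiv_symm hDs,
    eventually_fderiv_fderiv_fderiv_symm hs, eventually_differentiableAt hs,
    eventually_differentiableAt hDs] with y hCy hby h2y hsy hsy' hd hd'
  set M := ‖(s y, fderiv ℝ s y, fderiv ℝ (fderiv ℝ s) y)‖ with hM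
  obtain ⟨hM0, hM1, hM2⟩ : ‖s y‖ ≤ M ∧ ‖fderiv ℝ s y‖ ≤ M ∧ ‖fderiv ℝ (fderiv ℝ s) y‖ ≤ M := by
    simp [hM, Prod.norm_mk]
  have hD : fderiv ℝ (fun y => (s y, fderiv ℝ s y, fderiv ℝ s y)) y =
      (fderiv ℝ s y).prod ((fderiv ℝ (fderiv ℝ s) y).prod (fderiv ℝ (fderiv ℝ s) y)) :=
    (hd.hasFDerivAt.prodMk (hd'.hasFDerivAt.prodMk hd'.hasFDerivAt)).fderiv
  have hjet : ‖((s y, fderiv ℝ s y, fderiv ℝ s y), fderiv ℝ (fderiv ℝ s) y,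
      fderiv ℝ (fun y => (s y, fderiv ℝ s y, fderiv ℝ s y)) y)‖ ≤ M := by
    rw [hD]
    simp [Prod.norm_mk, opNorm_prod, hM0, hM1, hM2]
  have hsy_swap : ∀ a b c, fderiv ℝ (fderiv ℝ (fderiv ℝ s)) y a b c =
      fderiv ℝ (fderiv ℝ (fderiv ℝ s)) y b a c := fun a b c => by rw [hsy]
  have hS : fderiv ℝ (fderiv ℝ (fderiv ℝ s)) y ∈ S := ⟨hsy_swap, hsy'⟩
  refine (hCy _ hS).trans ?_
  rw [h2y, mul_assoc]
  refine (mul_le_mul_of_nonneg_right (le_abs_self C) (norm_nonneg _)).trans ?_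
  gcongr
  exact (A₂ y).le_of_opNorm_le_of_le hby.le hjet

/-- Along each segment that starts at a point near which `s` vanishes, the two-jet of `s` satisfies
a linear differential inequality, so that it vanishes by Grönwall's inequality. -/
theorem eventually_eq_zero_of_mem_closure {s : V → E} {y₀ : V} {C : ℝ}
    (hs : ContDiffAt ℝ ∞ s y₀)
    (hC : ∀ᶠ y in 𝓝 y₀, ‖fderiv ℝ (fderiv ℝ (fderiv ℝ s)) y‖ ≤
      C * ‖(s y, fderiv ℝ s y, fderiv ℝ (fderiv ℝ s) y)‖)
    (hcl : y₀ ∈ closure {y | ∀ᶠ z in 𝓝 y, s z = 0}) : ∀ᶠ y in 𝓝 y₀, s y = 0 := by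
  have hDs : ContDiffAt ℝ ∞ (fderiv ℝ s) y₀ := hs.fderiv_right le_rfl
  have hD2s : ContDiffAt ℝ ∞ (fderiv ℝ (fderiv ℝ s)) y₀ := hDs.fderiv_right le_rfl
  let f : V → E × (V →L[ℝ] E) × (V →L[ℝ] V →L[ℝ] E) :=
    fun y => (s y, fderiv ℝ s y, fderiv ℝ (fderiv ℝ s) y)
  obtain ⟨r, hr, hball⟩ := Metric.eventually_nhds_iff_ball.1 (hC.and
    ((eventually_differentiableAt hs).and ((eventually_differentiableAt hDs).and
      (eventually_differentiableAt hD2s))))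
  let f' : V → V →L[ℝ] E × (V →L[ℝ] E) × (V →L[ℝ] V →L[ℝ] E) := fun y =>
    (fderiv ℝ s y).prod ((fderiv ℝ (fderiv ℝ s) y).prod (fderiv ℝ (fderiv ℝ (fderiv ℝ s)) y))
  have hf : ∀ y ∈ Metric.ball y₀ r, HasFDerivAt f (f' y) y := fun y hy =>
    (hball y hy).2.1.hasFDerivAt.prodMk
      ((hball y hy).2.2.1.hasFDerivAt.prodMk (hball y hy).2.2.2.hasFDerivAt)
  have hbound : ∀ y ∈ Metric.ball y₀ r, ‖f' y‖ ≤ max 1 C * ‖f y‖ := by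
    intro y hy
    obtain ⟨hM1, hM2⟩ : ‖fderiv ℝ s y‖ ≤ ‖f y‖ ∧ ‖fderiv ℝ (fderiv ℝ s) y‖ ≤ ‖f y‖ := by
      simp [f, Prod.norm_mk]
    have h1 : ‖f y‖ ≤ max 1 C * ‖f y‖ := le_mul_of_one_le_left (norm_nonneg _) (le_max_left _ _)
    have h2 : C * ‖f y‖ ≤ max 1 C * ‖f y‖ := by gcongr; exact le_max_right _ _
    simp only [f', opNorm_prod, Prod.norm_mk]
    exact max_le (hM1.trans h1) (max_le (hM2.trans h1) ((hball y hy).1.trans h2))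
  obtain ⟨y₁, hy₁b, hy₁⟩ := mem_closure_iff.1 hcl _ Metric.isOpen_ball (Metric.mem_ball_self hr)
  have hf₁ : f y₁ = 0 := by
    have e0 : s =ᶠ[𝓝 y₁] fun _ => 0 := hy₁
    have e1 : fderiv ℝ s =ᶠ[𝓝 y₁] 0 := by simpa using e0.fderiv
    have e2 : fderiv ℝ (fderiv ℝ s) =ᶠ[𝓝 y₁] 0 := by simpa using e1.fderiv
    exact Prod.ext e0.eq_of_nhds (Prod.ext e1.eq_of_nhds e2.eq_of_nhds)
  filter_upwards [Metric.ball_mem_nhds y₀ hr] with y hy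
  have hseg : ∀ t ∈ Icc (0 : ℝ) 1, AffineMap.lineMap y₁ y t ∈ Metric.ball y₀ r := fun t ht =>
    (convex_ball y₀ r).lineMap_mem hy₁b hy ht
  have hg : ∀ t ∈ Icc (0 : ℝ) 1, HasDerivAt (fun t : ℝ => f (AffineMap.lineMap y₁ y t))
      (f' (AffineMap.lineMap y₁ y t) (y - y₁)) t := fun t ht =>
    (hf _ (hseg t ht)).comp_hasDerivAt t AffineMap.hasDerivAt_lineMap
  have := eq_zero_of_abs_deriv_le_mul_abs_self_of_eq_zero_right (K := max 1 C * ‖y - y₁‖)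
    (fun t ht => (hg t ht).continuousAt.continuousWithinAt)
    (fun t ht => (hg t (Ico_subset_Icc_self ht)).hasDerivWithinAt) (by simpa using hf₁)
    (fun t ht => by
      refine (le_opNorm _ _).trans ?_
      have := hbound _ (hseg t (Ico_subset_Icc_self ht))
      calc _ ≤ (max 1 C * ‖f (AffineMap.lineMap y₁ y t)‖) * ‖y - y₁‖ := by gcongr
        _ = _ := by ring) 1 (by simp)
  simp only [AffineMap.lineMap_apply_one] at this
  exact congrArg Prod.fst this

end FiniteType

/-! ### Conformal Killing forms in coordinates -/

section Coordinates

-- the normed structures on iterated spaces of linear maps are found only at this depth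
set_option maxSynthPendingDepth 3

open Function Set ContinuousLinearMap Filter Topology

variable {n k : ℕ}

lemma isInvertible_of_nondegenerate {B : Model n →L[ℝ] Model n →L[ℝ] ℝ}
    (hn : ∀ u, (∀ v, B u v = 0) → u = 0) : B.IsInvertible := by
  have hd : Module.finrank ℝ (Model n) = Module.finrank ℝ (Model n →L[ℝ] ℝ) :=
    (Subspace.dual_finrank_eq (K := ℝ) (V := Model n)).symm.trans
      (LinearMap.toContinuousLinearMap (𝕜 := ℝ) (E := Model n) (F' := ℝ)).finrank_eq
  have hinj : Injective B.toLinearMap := (injective_iff_map_eq_zero _).2 fun u hu =>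
    hn u fun v => congrArg (fun f : Model n →L[ℝ] ℝ => f v) hu
  refine ⟨(LinearEquiv.ofInjectiveOfFinrankEq B.toLinearMap hinj hd).toContinuousLinearEquiv, ?_⟩
  ext u v
  rfl

/-- The Christoffel symbols at `y` as a bilinear map. -/
noncomputable def christoffelL (G : Model n → Model n →L[ℝ] Model n →L[ℝ] ℝ) (y : Model n) :
    Model n →L[ℝ] Model n →L[ℝ] Model n :=
  compL ℝ (Model n) (Model n →L[ℝ] ℝ) (Model n) (inverse (G y)) ∘L
    ((1 / 2 : ℝ) • (fderiv ℝ G y + (fderiv ℝ G y).flip -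
      (flipₗᵢ ℝ (Model n) (Model n) ℝ).toContinuousLinearEquiv.toContinuousLinearMap ∘L
        (fderiv ℝ G y).flip))

lemma contDiffAt_christoffelL {G : Model n → Model n →L[ℝ] Model n →L[ℝ] ℝ} {y₀ : Model n}
    (hG : ContDiffAt ℝ ∞ G y₀) (hn : ∀ u, (∀ v, G y₀ u v = 0) → u = 0) :
    ContDiffAt ℝ ∞ (christoffelL G) y₀ := by
  have hinv : ContDiffAt ℝ ∞ (fun y => inverse (G y)) y₀ :=
    (isInvertible_of_nondegenerate hn).contDiffAt_map_inverse.comp y₀ hG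
  have hD : ContDiffAt ℝ ∞ (fderiv ℝ G) y₀ := hG.fderiv_right le_rfl
  have hD' : ContDiffAt ℝ ∞ (fun y => (fderiv ℝ G y).flip) y₀ :=
    (flipₗᵢ ℝ (Model n) (Model n) (Model n →L[ℝ] ℝ)).contDiff.contDiffAt.comp y₀ hD
  exact (contDiffAt_compL (Model n) hinv).clm_comp
    (((hD.add hD').sub (contDiffAt_const.clm_comp hD')).const_smul _)

set_option maxHeartbeats 1000000 in
/-- Unique continuation for conformal Killing forms in coordinates. -/
theorem eventually_eq_zero_of_conformalKillingAt (hn : 3 ≤ n) (hk : k + 2 ≤ n)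
    {G : Model n → Model n →L[ℝ] Model n →L[ℝ] ℝ} {s : Model n → Model n [⋀^Fin (k + 1)]→L[ℝ] ℝ}
    {y₀ : Model n} (hG : ContDiffAt ℝ ∞ G y₀) (hs : ContDiffAt ℝ ∞ s y₀)
    (hsymm : ∀ u v, G y₀ u v = G y₀ v u) (hnd : ∀ u, (∀ v, G y₀ u v = 0) → u = 0)
    (h : ∀ᶠ y in 𝓝 y₀, ConformalKillingAt G s y)
    (hcl : y₀ ∈ closure {y | ∀ᶠ z in 𝓝 y, s z = 0}) : ∀ᶠ y in 𝓝 y₀, s y = 0 := by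
  have hΨ : ContDiffAt ℝ ∞ (fun y => killingPart k (G y)) y₀ :=
    (contDiff_killingPart.of_le le_top).contDiffAt.comp y₀ hG
  have hA : ContDiffAt ℝ ∞ (fun y => connectionPart k (christoffelL G y)) y₀ :=
    (contDiff_connectionPart.of_le le_top).contDiffAt.comp y₀ (contDiffAt_christoffelL hG hnd)
  have heq : ∀ᶠ y in 𝓝 y₀, ∃ t,
      fderiv ℝ s y = connectionPart k (christoffelL G y) (s y) + killingPart k (G y) t := by
    filter_upwards [h] with y ⟨τ, ρ, hy⟩
    refine ⟨(τ, ρ), ?_⟩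
    ext u v
    have := hy u v
    rw [covDeriv, sub_eq_iff_eq_add'] at this
    rw [add_apply, ContinuousAlternatingMap.add_apply, killingPart_apply, connectionPart_apply]
    exact this
  obtain ⟨C, hC⟩ := exists_norm_third_fderiv_le hs hΨ hA heq (killingPart_injective hk hsymm hnd)
    fun T h12 h23 hT => eq_zero_of_symmetric_of_mem_range_killingPart hn hk hsymm hnd h12 h23 hT
  exact eventually_eq_zero_of_mem_closure hs hC hcl

end Coordinates

/-! ### From charts to the manifold -/

section Manifold

open Function Set Filter Topology

variable {n k : ℕ} {M : Type*} [TopologicalSpace M] [ChartedSpace (Model n) M]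
  {c : ConformalStructure n M} {e : OpenPartialHomeomorph M (Model n)} {y : Model n}

lemma WeightedForm.vanishesAt_iff {w : ℝ} (σ : WeightedForm c k w) (g : c.metrics) (x : M) :
    σ.VanishesAt x ↔ (σ.rep g).val x = 0 := by
  refine ⟨fun h => h g, fun h g' => ?_⟩
  obtain ⟨Υ, hΥ⟩ := (c.mem_iff g g.2 g').1 g'.2
  rw [σ.rescale g g' Υ hΥ x, h, smul_zero]

variable [IsManifold (𝓡 n) ∞ M]

lemma bijective_chartFrame (he : e ∈ atlas (Model n) M) (hy : y ∈ e.target) :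
    Bijective (chartFrame e y) := by
  have : IsManifold (𝓡 n) 1 M := IsManifold.of_le (n := ∞) (by exact_mod_cast le_top)
  exact (mdifferentiable_of_mem_atlas (I := 𝓡 n) he).symm.mfderiv_bijective hy

lemma formInChart_eq_zero_iff (s : ∀ x : M, TangentSpace (𝓡 n) x [⋀^Fin k]→L[ℝ] ℝ)
    (he : e ∈ atlas (Model n) M) (hy : y ∈ e.target) :
    formInChart s e y = 0 ↔ s (e.symm y) = 0 := by
  constructor
  · intro h
    ext v
    obtain ⟨w, hw⟩ := (bijective_chartFrame he hy).2.comp_left v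
    rw [← hw]
    exact congrArg (fun f => f w) h
  · intro h
    rw [formInChart, h]
    rfl

lemma bilinInChart_nondegenerate (g : PseudoRiemannianMetric n M) (he : e ∈ atlas (Model n) M)
    (hy : y ∈ e.target) {u : Model n} (hu : ∀ v, bilinInChart g.val e y u v = 0) : u = 0 := by
  have hb := bijective_chartFrame he hy
  refine hb.1 ?_
  rw [map_zero]
  refine g.nondegenerate _ _ fun w => ?_
  obtain ⟨v, rfl⟩ := hb.2 w
  exact hu v

/-- In the coordinates of a chart, the weighted form vanishes near `e x` iff it vanishes near
`x`. -/
lemma eventually_formInChart_eq_zero_iff (s : ∀ x : M, TangentSpace (𝓡 n) x [⋀^Fin k]→L[ℝ] ℝ)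
    (he : e ∈ atlas (Model n) M) {x : M} (hx : x ∈ e.source) :
    (∀ᶠ y in 𝓝 (e x), formInChart s e y = 0) ↔ ∀ᶠ z in 𝓝 x, s z = 0 := by
  constructor
  · intro h
    filter_upwards [(e.continuousAt hx).eventually h, e.open_source.mem_nhds hx] with z hz hzs
    rw [formInChart_eq_zero_iff s he (e.map_source hzs), e.left_inv hzs] at hz
    exact hz
  · intro h
    have hx' := e.map_source hx
    have hc := e.continuousAt_symm hx'
    rw [ContinuousAt, e.left_inv hx] at hc
    filter_upwards [hc.eventually h, e.open_target.mem_nhds hx'] with y hy hyt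
    exact (formInChart_eq_zero_iff s he hyt).2 hy

lemma DiffForm.isOpen_ne_zero (s : DiffForm n M k) : IsOpen {x | s.val x ≠ 0} := by
  rw [isOpen_iff_mem_nhds]
  intro x hx
  let e := chartAt (Model n) x
  have he : e ∈ atlas (Model n) M := chart_mem_atlas _ x
  have hxs : x ∈ e.source := mem_chart_source _ x
  have hc : ContinuousAt (formInChart s.val e) (e x) :=
    (s.smooth e he).continuousOn.continuousAt (e.open_target.mem_nhds (e.map_source hxs))
  have h0 : formInChart s.val e (e x) ≠ 0 := by
    rw [Ne, formInChart_eq_zero_iff s.val he (e.map_source hxs), e.left_inv hxs]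
    exact hx
  filter_upwards [(e.continuousAt hxs).eventually (hc.eventually_ne h0),
    e.open_source.mem_nhds hxs] with z hz hzs
  rw [Ne, formInChart_eq_zero_iff s.val he (e.map_source hzs), e.left_inv hzs] at hz
  exact hz

/-- The interior of the zero set of a conformal Killing form is closed. -/
lemma WeightedForm.IsConformalKilling.isClosed_interior (hn : 3 ≤ n) (hk : k + 2 ≤ n)
    {σ : WeightedForm c (k + 1) (k + 2)} (hσ : σ.IsConformalKilling) (g : c.metrics) :
    IsClosed (interior {x | (σ.rep g).val x = 0}) := by
  refine isClosed_of_closure_subset fun x hx => ?_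
  let e := chartAt (Model n) x
  have he : e ∈ atlas (Model n) M := chart_mem_atlas _ x
  have hxs : x ∈ e.source := mem_chart_source _ x
  have hxt := e.map_source hxs
  have ht : e.target ∈ 𝓝 (e x) := e.open_target.mem_nhds hxt
  rw [mem_interior_iff_mem_nhds]
  refine (eventually_formInChart_eq_zero_iff (σ.rep g).val he hxs).1 ?_
  refine eventually_eq_zero_of_conformalKillingAt hn hk ((g.1.smooth e he).contDiffAt ht)
    (((σ.rep g).smooth e he).contDiffAt ht) (fun u v => g.1.symm _ _ _)
    (fun u hu => bilinInChart_nondegenerate g.1 he hxt hu)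
    (mem_of_superset ht fun y hy => hσ g e he y hy) ?_
  rw [mem_closure_iff_frequently] at hx ⊢
  refine (e.continuousAt hxs).frequently ?_
  refine (hx.and_eventually (e.open_source.mem_nhds hxs)).mono fun z ⟨hz, hzs⟩ => ?_
  exact (eventually_formInChart_eq_zero_iff (σ.rep g).val he hzs).2 (mem_interior_iff_mem_nhds.1 hz)

end Manifold

end ConfKilling

theorem mainTheorem4 (n k : ℕ) (hn : 3 ≤ n) (hk : k + 2 ≤ n)
    (M : Type*) [TopologicalSpace M] [ChartedSpace (EuclideanSpace ℝ (Fin n)) M]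
    [IsManifold (𝓡 n) ∞ M] [ConnectedSpace M]
    (c : ConfKilling.ConformalStructure n M)
    (σ : ConfKilling.WeightedForm c (k + 1) (k + 2)) (hσ : σ.IsConformalKilling)
    (hne : ∃ x, ¬ σ.VanishesAt x) :
    IsOpen {x | ¬ σ.VanishesAt x} ∧ Dense {x | ¬ σ.VanishesAt x} := by
  obtain ⟨g⟩ : Nonempty c.metrics := c.nonempty.to_subtype
  simp only [σ.vanishesAt_iff g] at hne ⊢
  refine ⟨(σ.rep g).isOpen_ne_zero, ?_⟩
  have hclopen : IsClopen (interior {x | (σ.rep g).val x = 0}) :=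
    ⟨hσ.isClosed_interior hn hk g, isOpen_interior⟩
  rcases isClopen_iff.1 hclopen with h | h
  · exact interior_eq_empty_iff_dense_compl.1 h
  · obtain ⟨x, hx⟩ := hne
    have hx' : x ∈ interior {x | (σ.rep g).val x = 0} := by rw [h]; exact Set.mem_univ x
    exact absurd (interior_subset hx') hx
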